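/- Let $\Bbbk$ be a field and let $\mathcal P=(\mathcal P(n))_{n\ge 0}$ be a symmetric operad in $\Bbbk$-vector spaces, with right $\mathbb S_n$-actions, partial compositions $\circ_i$ and identity $\mathbf 1\in\mathcal P(1)$. Definitions. $\mathcal P$ is *2-unitary* if $\mathcal P(0)=\Bbbk \mathbf 1_0$ is one-dimensional and there is $\mathbf 1_2\in\mathcal P(2)$ with $\mathbf 1_2\circ_1\mathbf 1_0=\mathbf 1=\mathbf 1_2\circ_2\mathbf 1_0$. A family $I=(I(n))_{n\ge0}$ of $\mathbb S_n$-submodules $I(n)\subseteq\mathcal P(n)$ is a *left ideal* if $\mu\circ_i x\in I$, a *right ideal* if $x\circ_i\mu\in I$, for all $\mu\in\mathcal P$, $x\in I$ and all $i$, and an *ideal* if it is both. $\mathcal P$ is *left (right) artinian* if every descending chain of left (right) ideals stabilizes, and *semiprime* if every ideal $I$ with $x\circ_i y=0$ for all $x,y\in I$ and all $i$ is zero. A *derivation* of $\mathcal P$ is a family of linear maps $\partial:\mathcal P(n)\to\mathcal P(n)$ commuting with the $\mathbb S_n$-actions and satisfying $\partial(\mu\circ_i\nu)=\partial(\mu)\circ_i\nu+\mu\circ_i\partial(\nu)$;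 it is *inner* if for some $\lambda\in\mathcal P(1)$ one has $\partial(\theta)=\lambda\circ_1\theta-\sum_{i=1}^n\theta\circ_i\lambda$ for all $n$ and all $\theta\in\mathcal P(n)$. Under the commutator the derivations form a Lie algebra $\mathrm{Der}(\mathcal P)$, and the inner ones a Lie ideal $\mathrm{IDer}(\mathcal P)$; put $H^1(\mathcal P)=\mathrm{Der}(\mathcal P)/\mathrm{IDer}(\mathcal P)$. For a possibly nonunital associative algebra $B$, $\mathrm{Der}(B)$ is the Lie algebra of its derivations and $HH^1(B)$ is the quotient of $\mathrm{Der}(B)$ by the inner derivations $x\mapsto bx-xb$, $b\in B$. If $\mathcal P$ is 2-unitary, the algebra $\mathcal P(1)$ (with product $\circ_1$) has the augmentation $\varepsilon$ given by $a\circ_1\mathbf 1_0=\varepsilon(a)\mathbf 1_0$; let $\bar A=\ker\varepsilon$ be its augmentation ideal. **Theorem.** Let $\mathcal P$ be a 2-unitary operad over $\Bbbk$ that is left artinian or right artinian, and semiprime. Then there is a short exact sequence of Lie algebras $$0\to\Bbbk\xrightarrow{\ \iota\ }\mathrm{Der}(\mathcal P)\xrightarrow{\ \rho\ }\mathrm{Der}(\bar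 A)\to0,$$ where $\Bbbk$ is the one-dimensional abelian Lie algebra, $\iota(c)$ is the derivation $\theta\mapsto(n-1)c\,\theta$ for $\theta\in\mathcal P(n)$, and $\rho(\partial)=\partial|_{\bar A}$. Consequently, there is a Lie algebra isomorphism $\mathrm{Der}(\mathcal P)\cong\Bbbk\rtimes\mathrm{Der}(\bar A)$ compatible with $\iota$ and $\rho$, and $\rho$ induces an isomorphism of Lie algebras (in particular of vector spaces) $H^1(\mathcal P)\cong HH^1(\bar A)$. -/

import Mathlib

universe u v

attribute [local instance] LieRing.ofAssociativeRing

/-! ## Inserting a block in place of one letter -/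

/-- Positions of the `r = m + n - 1` inputs of `μ ∘ᵢ ν` (`μ` of arity `m`, `ν` of arity `n`,
all positions counted from `0`).  The input `t` of `ν` sits at position `i + t`; the input
`q ≠ i` of `μ` sits at position `q` if `q < i`, and at position `q + n - 1` if `q > i`. -/
def blockPos {m n r : ℕ} (i : Fin m) (h : r + 1 = m + n) :
    Fin n ⊕ {q : Fin m // q ≠ i} → Fin r
  | Sum.inl t => ⟨i + t, by omega⟩
  | Sum.inr q =>
      ⟨if q.1 < i then (q.1 : ℕ) else q.1 + n - 1, by
        have h1 : (q.1 : ℕ) ≠ i := fun e => q.2 (Fin.ext e)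
        split_ifs with hq
        · have : (q.1 : ℕ) < i := hq
          omega
        · have : ¬ (q.1 : ℕ) < i := hq
          omega⟩

theorem blockPos_bijective {m n r : ℕ} (i : Fin m) (h : r + 1 = m + n) :
    Function.Bijective (blockPos i h) := by
  rw [Fintype.bijective_iff_injective_and_card]
  constructor
  · rintro (a | ⟨a, ha⟩) (b | ⟨b, hb⟩) hab
    · have := congrArg Fin.val hab
      simp only [blockPos] at this
      congr 1
      exact Fin.ext (by omega)
    · have := congrArg Fin.val hab
      have hb' : (b : ℕ) ≠ i := fun e => hb (Fin.ext e)
      simp only [blockPos, Fin.lt_def] at this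
      split_ifs at this <;> omega
    · have := congrArg Fin.val hab
      have ha' : (a : ℕ) ≠ i := fun e => ha (Fin.ext e)
      simp only [blockPos, Fin.lt_def] at this
      split_ifs at this <;> omega
    · have := congrArg Fin.val hab
      have ha' : (a : ℕ) ≠ i := fun e => ha (Fin.ext e)
      have hb' : (b : ℕ) ≠ i := fun e => hb (Fin.ext e)
      simp only [blockPos, Fin.lt_def] at this
      have : (a : ℕ) = b := by split_ifs at this <;> omega
      congr 2
      exact Fin.ext this
  · have h1 : Fintype.card {q : Fin m // q ≠ i} = m - 1 := by
      simp [Fintype.card_subtype_compl]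
    rw [Fintype.card_sum, h1, Fintype.card_fin, Fintype.card_fin]
    have := i.2
    omega

noncomputable def blockEquiv {m n r : ℕ} (i : Fin m) (h : r + 1 = m + n) :
    Fin n ⊕ {q : Fin m // q ≠ i} ≃ Fin r :=
  Equiv.ofBijective (blockPos i h) (blockPos_bijective i h)

/-- The permutation `σ' = 1ₘ ∘ᵢ σ` of `m + n - 1` letters: it permutes the block of the
`n` inputs starting at `i` by `σ` and fixes everything else. -/
noncomputable def permInner {m n r : ℕ} (i : Fin m) (h : r + 1 = m + n)
    (σ : Equiv.Perm (Fin n)) : Equiv.Perm (Fin r) :=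
  (blockEquiv i h).symm.trans
    ((Equiv.sumCongr σ (Equiv.refl {q : Fin m // q ≠ i})).trans (blockEquiv i h))

/-- The permutation `φ'' = φ ∘ᵢ 1ₙ` of `m + n - 1` letters: it moves the block of `n` letters in
place of the letter `i` to the block in place of `φ i`, keeping the order inside the block, and
permutes the other letters as `φ` does. -/
noncomputable def permOuter {m n r : ℕ} (i : Fin m) (h : r + 1 = m + n)
    (φ : Equiv.Perm (Fin m)) : Equiv.Perm (Fin r) :=
  (blockEquiv i h).symm.trans
    ((Equiv.sumCongr (Equiv.refl (Fin n))
      (φ.subtypeEquiv (fun q => by simp) :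
        {q : Fin m // q ≠ i} ≃ {q : Fin m // q ≠ φ i})).trans (blockEquiv (φ i) h))

/-! ## Operads -/

/-- A symmetric operad over `𝕜`, by partial compositions.  The partial composition
`comp i h μ ν = μ ∘ᵢ ν` lands in arity `r = m + n - 1`, which is expressed by `h : r + 1 = m + n`
(there is such an `i : Fin m` only if `m ≥ 1`, and then `r` is determined).  Inputs are numbered
from `0`.  `act σ θ` is the right action `θ ∗ σ` of the symmetric group. -/
structure SymmOperad (𝕜 : Type u) [CommRing 𝕜] where
  obj : ℕ → Type v
  [addCommGroup : ∀ n, AddCommGroup (obj n)]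
  [module : ∀ n, Module 𝕜 (obj n)]
  act : ∀ {n : ℕ}, Equiv.Perm (Fin n) → (obj n →ₗ[𝕜] obj n)
  act_one : ∀ {n : ℕ} (θ : obj n), act 1 θ = θ
  act_mul : ∀ {n : ℕ} (σ τ : Equiv.Perm (Fin n)) (θ : obj n), act (σ * τ) θ = act τ (act σ θ)
  one : obj 1
  comp : ∀ {m n r : ℕ} (_ : Fin m) (_ : r + 1 = m + n), obj m →ₗ[𝕜] obj n →ₗ[𝕜] obj r
  /-- `θ ∘ᵢ 𝟙 = θ` -/
  comp_one : ∀ {n : ℕ} (i : Fin n) (θ : obj n), comp i rfl θ one = θ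
  /-- `𝟙 ∘₁ θ = θ` -/
  one_comp : ∀ {n : ℕ} (θ : obj n), comp 0 (Nat.add_comm n 1) one θ = θ
  /-- `(l ∘ᵢ μ) ∘_{i-1+j} ν = l ∘ᵢ (μ ∘ⱼ ν)` -/
  comp_assoc : ∀ {l m n r s t : ℕ} (i : Fin l) (j : Fin m) (p : Fin r)
    (h₁ : r + 1 = l + m) (h₂ : t + 1 = r + n) (h₃ : s + 1 = m + n) (h₄ : t + 1 = l + s)
    (_ : (p : ℕ) = i + j) (lam : obj l) (μ : obj m) (ν : obj n),
    comp p h₂ (comp i h₁ lam μ) ν = comp i h₄ lam (comp j h₃ μ ν)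
  /-- `(l ∘ᵢ μ) ∘_{k-1+m} ν = (l ∘ₖ ν) ∘ᵢ μ` for `i < k` -/
  comp_comm : ∀ {l m n r s t : ℕ} (i k : Fin l) (p : Fin r) (q : Fin s)
    (h₁ : r + 1 = l + m) (h₂ : t + 1 = r + n) (h₃ : s + 1 = l + n) (h₄ : t + 1 = s + m)
    (_ : i < k) (_ : (p : ℕ) + 1 = k + m) (_ : (q : ℕ) = i)
    (lam : obj l) (μ : obj m) (ν : obj n),
    comp p h₂ (comp i h₁ lam μ) ν = comp q h₄ (comp k h₃ lam ν) μ
  /-- `μ ∘ᵢ (ν ∗ σ) = (μ ∘ᵢ ν) ∗ σ'` -/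
  comp_act : ∀ {m n r : ℕ} (i : Fin m) (h : r + 1 = m + n) (σ : Equiv.Perm (Fin n))
    (μ : obj m) (ν : obj n),
    comp i h μ (act σ ν) = act (permInner i h σ) (comp i h μ ν)
  /-- `(μ ∗ φ) ∘ᵢ ν = (μ ∘_{φ(i)} ν) ∗ φ''` -/
  act_comp : ∀ {m n r : ℕ} (i : Fin m) (h : r + 1 = m + n) (φ : Equiv.Perm (Fin m))
    (μ : obj m) (ν : obj n),
    comp i h (act φ μ) ν = act (permOuter i h φ) (comp (φ i) h μ ν)

attribute [instance] SymmOperad.addCommGroup SymmOperad.module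

/-! ## Derivations and Hochschild cohomology of nonunital associative algebras -/

section NonUnital

variable (𝕜 : Type u) [CommRing 𝕜] (B : Type v) [NonUnitalRing B] [Module 𝕜 B]
  [IsScalarTower 𝕜 B B] [SMulCommClass 𝕜 B B]

/-- The Lie algebra (under the commutator) of derivations of an associative, possibly
nonunital and noncommutative, algebra `B`. -/
def algDer : LieSubalgebra 𝕜 (Module.End 𝕜 B) where
  carrier := {D | ∀ a b, D (a * b) = D a * b + a * D b}
  zero_mem' := by intro a b; simp
  add_mem' := by
    intro D E hD hE a b
    simp only [LinearMap.add_apply, hD a b, hE a b, add_mul, mul_add]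
    abel
  smul_mem' := by
    intro c D hD a b
    simp only [LinearMap.smul_apply, hD a b, smul_add, smul_mul_assoc, mul_smul_comm]
  lie_mem' := by
    intro D E hD hE a b
    simp only [LieRing.of_associative_ring_bracket, LinearMap.sub_apply, Module.End.mul_apply,
      hD _ _, hE _ _, map_add, sub_mul, mul_sub]
    abel

/-- The Lie ideal of inner derivations `x ↦ b x - x b`, `b ∈ B`. -/
def algInnerDer : LieIdeal 𝕜 (algDer 𝕜 B) where
  carrier := {D | ∃ b : B, ∀ x, D.1 x = b * x - x * b}
  zero_mem' := ⟨0, by simp⟩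
  add_mem' := by
    rintro D E ⟨b, hb⟩ ⟨c, hc⟩
    refine ⟨b + c, fun x => ?_⟩
    change D.1 x + E.1 x = _
    rw [hb, hc, add_mul, mul_add]
    abel
  smul_mem' := by
    rintro c D ⟨b, hb⟩
    refine ⟨c • b, fun x => ?_⟩
    change c • D.1 x = _
    rw [hb, smul_sub, smul_mul_assoc, mul_smul_comm]
  lie_mem := by
    rintro E D ⟨b, hb⟩
    refine ⟨E.1 b, fun x => ?_⟩
    change E.1 (D.1 x) - D.1 (E.1 x) = _
    rw [hb, hb, map_sub, E.2 b x, E.2 x b]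
    abel

/-- The first Hochschild cohomology of a possibly nonunital associative algebra: derivations
modulo inner derivations. -/
abbrev HH1 : Type v := algDer 𝕜 B ⧸ algInnerDer 𝕜 B

end NonUnital

namespace SymmOperad

variable {𝕜 : Type u} [CommRing 𝕜] (P : SymmOperad.{u, v} 𝕜)

/-! ## Derivations of an operad -/

/-- The Lie algebra `Der(P)` (under the commutator) of derivations of an operad: families of linear
maps commuting with the symmetric group actions and satisfying the Leibniz rule for
partial compositions. -/
def Der : LieSubalgebra 𝕜 (∀ n, Module.End 𝕜 (P.obj n)) where
  carrier := {D | (∀ (n : ℕ) (σ : Equiv.Perm (Fin n)) (θ : P.obj n),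
      D n (P.act σ θ) = P.act σ (D n θ)) ∧
    ∀ (m n r : ℕ) (i : Fin m) (h : r + 1 = m + n) (μ : P.obj m) (ν : P.obj n),
      D r (P.comp i h μ ν) = P.comp i h (D m μ) ν + P.comp i h μ (D n ν)}
  zero_mem' := by
    refine ⟨fun n σ θ => ?_, fun m n r i h μ ν => ?_⟩ <;> simp
  add_mem' := by
    rintro D E ⟨hD, hD'⟩ ⟨hE, hE'⟩
    refine ⟨fun n σ θ => ?_, fun m n r i h μ ν => ?_⟩
    · simp only [Pi.add_apply, LinearMap.add_apply, hD, hE, map_add]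
    · simp only [Pi.add_apply, LinearMap.add_apply, hD', hE', map_add]
      abel
  smul_mem' := by
    rintro c D ⟨hD, hD'⟩
    refine ⟨fun n σ θ => ?_, fun m n r i h μ ν => ?_⟩
    · simp only [Pi.smul_apply, LinearMap.smul_apply, hD, map_smul]
    · simp only [Pi.smul_apply, LinearMap.smul_apply, hD', map_smul, smul_add]
  lie_mem' := by
    rintro D E ⟨hD, hD'⟩ ⟨hE, hE'⟩
    refine ⟨fun n σ θ => ?_, fun m n r i h μ ν => ?_⟩
    · simp only [LieRing.of_associative_ring_bracket, Pi.sub_apply, Pi.mul_apply,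
        LinearMap.sub_apply, Module.End.mul_apply, hD, hE, map_sub]
    · simp only [LieRing.of_associative_ring_bracket, Pi.sub_apply, Pi.mul_apply,
        LinearMap.sub_apply, Module.End.mul_apply, hD', hE', map_sub, map_add]
      abel

/-- The value `ad_λ(θ) = λ ∘₁ θ - ∑ᵢ θ ∘ᵢ λ`, for `λ ∈ P(1)` and `θ ∈ P(n)`. -/
def adFun (lam : P.obj 1) {n : ℕ} (θ : P.obj n) : P.obj n :=
  P.comp 0 (Nat.add_comm n 1) lam θ - ∑ i : Fin n, P.comp i rfl θ lam

/-- The Lie ideal `IDer(P)` of inner derivations: those of the form `ad_λ`, `λ ∈ P(1)`. -/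
def innerDer : LieIdeal 𝕜 P.Der where
  carrier := {D | ∃ lam : P.obj 1, ∀ (n : ℕ) (θ : P.obj n), D.1 n θ = P.adFun lam θ}
  zero_mem' := ⟨0, fun n θ => by simp [adFun]⟩
  add_mem' := by
    rintro D E ⟨b, hb⟩ ⟨c, hc⟩
    refine ⟨b + c, fun n θ => ?_⟩
    change D.1 n θ + E.1 n θ = _
    rw [hb, hc]
    simp only [adFun, map_add, LinearMap.add_apply, Finset.sum_add_distrib]
    abel
  smul_mem' := by
    rintro c D ⟨b, hb⟩
    refine ⟨c • b, fun n θ => ?_⟩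
    change c • D.1 n θ = _
    rw [hb]
    simp only [adFun, map_smul, LinearMap.smul_apply, smul_sub, Finset.smul_sum]
  lie_mem := by
    rintro E D ⟨b, hb⟩
    refine ⟨E.1 1 b, fun n θ => ?_⟩
    change E.1 n (D.1 n θ) - D.1 n (E.1 n θ) = _
    rw [hb, hb]
    simp only [adFun, map_sub, map_sum, E.2.2, Finset.sum_add_distrib]
    abel

/-- The first cohomology group `H¹(P) = Der(P) / IDer(P)`, with its quotient Lie algebra
structure. -/
abbrev H1 : Type v := P.Der ⧸ P.innerDer

/-! ## Unitary and 2-unitary operads, the algebra `P(1)` and its augmentation ideal -/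

/-- `u₀` is a `0`-unit: `P(0)` is free of rank one on `u₀`. -/
def IsZeroUnit (u₀ : P.obj 0) : Prop :=
  Function.Bijective (fun c : 𝕜 => c • u₀)

/-- `u₂` is a `2`-unit relative to `u₀`: `u₂ ∘₁ u₀ = 𝟙 = u₂ ∘₂ u₀`. -/
def IsTwoUnit (u₀ : P.obj 0) (u₂ : P.obj 2) : Prop :=
  P.comp (0 : Fin 2) (by omega) u₂ u₀ = P.one ∧ P.comp (1 : Fin 2) (by omega) u₂ u₀ = P.one

/-- `P` is `2`-unitary: it is unitary, with a `0`-unit that admits a `2`-unit. -/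
def IsTwoUnitary : Prop :=
  ∃ u₀ : P.obj 0, P.IsZeroUnit u₀ ∧ ∃ u₂ : P.obj 2, P.IsTwoUnit u₀ u₂

/-- `P(1)` is an associative algebra under `∘₁`, with unit `𝟙`. -/
instance ringOne : Ring (P.obj 1) :=
  { P.addCommGroup 1 with
    mul := fun a b => P.comp (0 : Fin 1) rfl a b
    one := P.one
    left_distrib := fun a b c => (P.comp (0 : Fin 1) rfl a).map_add b c
    right_distrib := fun a b c => by
      change P.comp (0 : Fin 1) rfl (a + b) c = _
      rw [map_add]; rfl
    zero_mul := fun a => by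
      change P.comp (0 : Fin 1) rfl 0 a = 0
      simp
    mul_zero := fun a => (P.comp (0 : Fin 1) rfl a).map_zero
    mul_assoc := fun a b c => P.comp_assoc 0 0 0 rfl rfl rfl rfl rfl a b c
    one_mul := fun a => P.one_comp a
    mul_one := fun a => P.comp_one 0 a }

instance algebraOne : Algebra 𝕜 (P.obj 1) :=
  Algebra.ofModule
    (fun c a b => by
      change P.comp (0 : Fin 1) rfl (c • a) b = c • P.comp (0 : Fin 1) rfl a b
      simp)
    (fun c a b => by
      change P.comp (0 : Fin 1) rfl a (c • b) = c • P.comp (0 : Fin 1) rfl a b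
      simp)

/-- The augmentation ideal of `P(1)`, as a nonunital algebra: the elements `a` that act as `0` on
`P(0)` by `x ↦ a ∘₁ x`.  If `P(0)` is free on a `0`-unit `u₀`, then `a ∘₁ u₀ = ε(a) u₀` defines
the augmentation `ε : P(1) → 𝕜`, and this is the kernel of `ε`. -/
def augIdeal : NonUnitalSubalgebra 𝕜 (P.obj 1) where
  carrier := {a | ∀ x : P.obj 0, P.comp (0 : Fin 1) (Nat.add_comm 0 1) a x = (0 : P.obj 0)}
  zero_mem' := by intro x; simp
  add_mem' := by
    intro a b ha hb x
    simp only [map_add, LinearMap.add_apply, ha x, hb x, add_zero]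
  smul_mem' := by
    intro c a ha x
    simp only [map_smul, LinearMap.smul_apply, ha x, smul_zero]
  mul_mem' := by
    intro a b ha hb x
    have := P.comp_assoc (0 : Fin 1) (0 : Fin 1) (0 : Fin 1)
      (rfl : 1 + 1 = 1 + 1) (Nat.add_comm 0 1) (Nat.add_comm 0 1) (Nat.add_comm 0 1)
      rfl a b x
    rw [hb x, map_zero] at this
    exact this

/-! ## One-sided and two-sided ideals, chain conditions, semiprimeness -/

/-- A family of `𝕜 Sₙ`-submodules `I(n) ⊆ P(n)` with `μ ∘ᵢ x ∈ I` for `μ ∈ P`, `x ∈ I`. -/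
def IsLeftIdeal (I : ∀ n, Submodule 𝕜 (P.obj n)) : Prop :=
  (∀ (n : ℕ) (σ : Equiv.Perm (Fin n)), ∀ x ∈ I n, P.act σ x ∈ I n) ∧
  ∀ (m n r : ℕ) (i : Fin m) (h : r + 1 = m + n) (μ : P.obj m), ∀ x ∈ I n, P.comp i h μ x ∈ I r

/-- A family of `𝕜 Sₙ`-submodules `I(n) ⊆ P(n)` with `x ∘ᵢ ν ∈ I` for `x ∈ I`, `ν ∈ P`. -/
def IsRightIdeal (I : ∀ n, Submodule 𝕜 (P.obj n)) : Prop :=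
  (∀ (n : ℕ) (σ : Equiv.Perm (Fin n)), ∀ x ∈ I n, P.act σ x ∈ I n) ∧
  ∀ (m n r : ℕ) (i : Fin m) (h : r + 1 = m + n), ∀ x ∈ I m, ∀ ν : P.obj n, P.comp i h x ν ∈ I r

/-- An operadic (two-sided) ideal. -/
def IsIdeal (I : ∀ n, Submodule 𝕜 (P.obj n)) : Prop :=
  P.IsLeftIdeal I ∧ P.IsRightIdeal I

/-- Every descending chain of left ideals stabilizes. -/
def IsLeftArtinian : Prop :=
  ∀ I : ℕ → ∀ n, Submodule 𝕜 (P.obj n), (∀ t, P.IsLeftIdeal (I t)) → Antitone I →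
    ∃ N, ∀ t, N ≤ t → I t = I N

/-- Every descending chain of right ideals stabilizes. -/
def IsRightArtinian : Prop :=
  ∀ I : ℕ → ∀ n, Submodule 𝕜 (P.obj n), (∀ t, P.IsRightIdeal (I t)) → Antitone I →
    ∃ N, ∀ t, N ≤ t → I t = I N

/-- `P` is semiprime: an ideal `I` with `I² = 0`, that is, `x ∘ᵢ y = 0` for all `x, y ∈ I`
and all `i`, is zero. -/
def IsSemiprime : Prop :=
  ∀ I : ∀ n, Submodule 𝕜 (P.obj n), P.IsIdeal I →
    (∀ (m n r : ℕ) (i : Fin m) (h : r + 1 = m + n), ∀ x ∈ I m, ∀ y ∈ I n, P.comp i h x y = 0) →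
    ∀ n, I n = ⊥

end SymmOperad

/-!
Closing inputs with the `0`-unit `u₀` turns `P` into a semi-simplicial module, and every natural
construction below is compatible with these erasure operators.  The truncation ideals `ᵏΥ`, the
elements whose erasures in arities less than `k` all vanish, form a descending chain of ideals with
`ᵏΥ(n) = 0` for `n < k`.  If `P` is artinian on one side, the chain stabilises, hence `ᵏΥ = 0` for
some `k`; since `ᵃΥ ∘ ᵇΥ ⊆ ᵃ⁺ᵇ⁻¹Υ`, semiprimeness lowers `k` step by step down to `²Υ = 0`.

If `²Υ = 0`, an identity compatible with erasure holds as soon as it holds in arities `0` and `1`.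
So a derivation that kills `u₀` is determined by its restriction to `P(1) = 𝕜 𝟙 ⊕ Ā`, hence to
`Ā`, and a derivation `δ` of `Ā` extends to `P`: insert the elements `δ(θᵢ)`, where `θᵢ` is the
restriction of `θ` to its `i`-th input, in the powers of the `2`-unit.  On `P(0) = 𝕜 u₀` the
derivation `θ ↦ (n - 1) c θ` is multiplication by `-c`, so every derivation kills `u₀` after
subtracting exactly one of these.
-/

namespace SymmOperad

section Erase

variable {𝕜 : Type u} [CommRing 𝕜] (P : SymmOperad.{u, v} 𝕜) (u₀ : P.obj 0)

/-- The restriction operator `θ ↦ θ ∘ⱼ u₀`, which closes the input `j` with the `0`-unit.  These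
operators make `P` a semi-simplicial module. -/
def erase {n : ℕ} (j : Fin (n + 1)) : P.obj (n + 1) →ₗ[𝕜] P.obj n :=
  (P.comp j (rfl : n + 1 = n + 1 + 0)).flip u₀

theorem erase_erase {n : ℕ} {i j : Fin (n + 1)} (hij : i ≤ j) (θ : P.obj (n + 2)) :
    P.erase u₀ j (P.erase u₀ i.castSucc θ) = P.erase u₀ i (P.erase u₀ j.succ θ) :=
  P.comp_comm (m := 0) (n := 0) i.castSucc j.succ j i rfl rfl rfl rfl
    (Fin.castSucc_lt_succ_iff.2 hij) rfl rfl θ u₀ u₀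

theorem erase_comp_inner {m n r : ℕ} (i : Fin m) (j : Fin (n + 1)) (h : r + 1 + 1 = m + (n + 1))
    (μ : P.obj m) (ν : P.obj (n + 1)) :
    P.erase u₀ (blockPos i h (Sum.inl j)) (P.comp i h μ ν) =
      P.comp i (by omega) μ (P.erase u₀ j ν) :=
  P.comp_assoc (n := 0) i j _ h rfl rfl _ rfl μ ν u₀

theorem erase_comp_outer {m n r : ℕ} (k : Fin (m + 1)) (i : Fin m) (h : r + 1 + 1 = m + 1 + n)
    (μ : P.obj (m + 1)) (ν : P.obj n) :
    P.erase u₀ (blockPos (k.succAbove i) h (Sum.inr ⟨k, k.ne_succAbove i⟩))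
        (P.comp (k.succAbove i) h μ ν) =
      P.comp i (by omega) (P.erase u₀ k μ) ν := by
  rcases lt_or_gt_of_ne (k.succAbove_ne i) with hik | hki
  · have hi : (k.succAbove i : ℕ) = i := by
      rw [Fin.succAbove_of_succ_le k i ((k.succAbove_lt_iff_succ_le i).1 hik), Fin.val_castSucc]
    refine P.comp_comm (n := 0) (s := m) _ k _ i h rfl rfl _ hik ?_ hi.symm μ ν u₀
    simp only [blockPos, Fin.not_lt.2 hik.le, if_false]
    have := Fin.lt_def.1 hik
    omega
  · have hi : (k.succAbove i : ℕ) = i + 1 := by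
      rw [Fin.succAbove_of_le_castSucc k i ((k.lt_succAbove_iff_le_castSucc i).1 hki), Fin.val_succ]
    refine (P.comp_comm (m := 0) (r := m) k _ i _ rfl _ h rfl hki hi.symm ?_ μ u₀ ν).symm
    simp only [blockPos, hki, if_true]

/-- An input of `μ ∘ᵢ ν` comes either from `ν` or from an input of `μ` other than `i`. -/
@[elab_as_elim]
theorem input_cases {r : ℕ}
    {motive : ∀ m n : ℕ, Fin m → r + 1 + 1 = m + n → Fin (r + 1) → Prop}
    (inner : ∀ (m n : ℕ) (i : Fin m) (h : r + 1 + 1 = m + (n + 1)) (j : Fin (n + 1)),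
      motive m (n + 1) i h (blockPos i h (Sum.inl j)))
    (outer : ∀ (m n : ℕ) (k : Fin (m + 1)) (i : Fin m) (h : r + 1 + 1 = m + 1 + n),
      motive (m + 1) n (k.succAbove i) h
        (blockPos (k.succAbove i) h (Sum.inr ⟨k, k.ne_succAbove i⟩)))
    (m n : ℕ) (i : Fin m) (h : r + 1 + 1 = m + n) (p : Fin (r + 1)) : motive m n i h p := by
  obtain ⟨j | ⟨k, hk⟩, rfl⟩ := (blockPos_bijective i h).surjective p
  · obtain _ | n := n
    · exact j.elim0
    · exact inner m n i h j
  · obtain _ | m := m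
    · exact i.elim0
    · obtain ⟨i, rfl⟩ := Fin.exists_succAbove_eq hk.symm
      exact outer m n k i h

theorem exists_erase_act {n : ℕ} (j : Fin (n + 1)) (σ : Equiv.Perm (Fin (n + 1))) :
    ∃ τ : Equiv.Perm (Fin n), ∀ θ : P.obj (n + 1),
      P.erase u₀ j (P.act σ θ) = P.act τ (P.erase u₀ (σ j) θ) :=
  ⟨_, fun θ => P.act_comp (n := 0) j rfl σ θ u₀⟩

/-- A family of subsets of the `P(n)` closed under all the operators `erase`. -/
def IsEraseStable (S : ∀ n, Set (P.obj n)) : Prop :=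
  ∀ ⦃n : ℕ⦄ (j : Fin (n + 1)), ∀ x ∈ S (n + 1), P.erase u₀ j x ∈ S n

theorem isEraseStable_univ : P.IsEraseStable u₀ fun _ => Set.univ :=
  fun _ _ _ _ => Set.mem_univ _

variable {P u₀} in
theorem IsEraseStable.image2_comp {X Y : ∀ n, Set (P.obj n)}
    (hX : P.IsEraseStable u₀ X) (hY : P.IsEraseStable u₀ Y) :
    P.IsEraseStable u₀ fun r => {z | ∃ (m n : ℕ) (i : Fin m) (h : r + 1 = m + n),
      ∃ x ∈ X m, ∃ y ∈ Y n, P.comp i h x y = z} := by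
  rintro r p _ ⟨m, n, i, h, x, hx, y, hy, rfl⟩
  induction m, n, i, h, p using input_cases with
  | inner m n i h j =>
    exact ⟨m, n, i, _, x, hx, _, hY j y hy, (P.erase_comp_inner u₀ i j h x y).symm⟩
  | outer m n k i h =>
    exact ⟨m, n, i, _, _, hX k x hx, y, hy, (P.erase_comp_outer u₀ k i h x y).symm⟩

end Erase

section Truncation

variable {𝕜 : Type u} [CommRing 𝕜] (P : SymmOperad.{u, v} 𝕜) (u₀ : P.obj 0)

/-- The `k`-th truncation ideal `ᵏΥ`: the elements all of whose iterated erasures in arities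
less than `k` vanish. -/
def trunc (k : ℕ) : ∀ n, Submodule 𝕜 (P.obj n)
  | 0 => if 0 < k then ⊥ else ⊤
  | n + 1 => if n + 1 < k then ⊥ else ⨅ j, (trunc k n).comap (P.erase u₀ j)

variable {P u₀} {k : ℕ}

theorem trunc_of_lt {n : ℕ} (h : n < k) : P.trunc u₀ k n = ⊥ := by
  cases n <;> simp [trunc, h]

theorem eq_zero_of_mem_trunc {n : ℕ} (h : n < k) {x : P.obj n} (hx : x ∈ P.trunc u₀ k n) :
    x = 0 := by
  rwa [trunc_of_lt h] at hx

theorem isEraseStable_trunc : P.IsEraseStable u₀ fun n => P.trunc u₀ k n := by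
  intro n j x hx
  rcases lt_or_ge (n + 1) k with h | h
  · simp [eq_zero_of_mem_trunc h hx]
  · simp only [trunc, Nat.not_lt.2 h, if_false, SetLike.mem_coe, Submodule.mem_iInf] at hx
    exact hx j

/-- The truncation ideal is the largest erasure-stable family that vanishes in arities below `k`:
every membership in it is proved by exhibiting such a family. -/
theorem IsEraseStable.mem_trunc {S : ∀ n, Set (P.obj n)} (hS : P.IsEraseStable u₀ S)
    (hk : ∀ n < k, ∀ x ∈ S n, x = 0) {n : ℕ} {x : P.obj n} (hx : x ∈ S n) :
    x ∈ P.trunc u₀ k n := by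
  rcases lt_or_ge n k with h | h
  · simp [hk n h x hx]
  induction n with
  | zero => simp [trunc, Nat.le_zero.1 h]
  | succ n ih =>
    simp only [trunc, Nat.not_lt.2 h, if_false, Submodule.mem_iInf, Submodule.mem_comap]
    intro j
    rcases lt_or_ge n k with h' | h'
    · simp [hk n h' _ (hS j x hx)]
    · exact ih (hS j x hx) h'

theorem trunc_antitone : Antitone (P.trunc u₀) := fun _ _ hkl _ _ =>
  isEraseStable_trunc.mem_trunc fun _ hn _ => eq_zero_of_mem_trunc (hn.trans_le hkl)

theorem act_mem_trunc {n : ℕ} (σ : Equiv.Perm (Fin n)) {x : P.obj n}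
    (hx : x ∈ P.trunc u₀ k n) : P.act σ x ∈ P.trunc u₀ k n := by
  have hS : P.IsEraseStable u₀ fun n =>
      {z | ∃ (σ : Equiv.Perm (Fin n)) (x : P.obj n), x ∈ P.trunc u₀ k n ∧ P.act σ x = z} := by
    rintro n j _ ⟨σ, x, hx, rfl⟩
    obtain ⟨τ, hτ⟩ := P.exists_erase_act u₀ j σ
    exact ⟨τ, _, isEraseStable_trunc (σ j) x hx, (hτ x).symm⟩
  refine hS.mem_trunc ?_ ⟨σ, x, hx, rfl⟩
  rintro n hn _ ⟨σ, x, hx, rfl⟩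
  rw [eq_zero_of_mem_trunc hn hx, map_zero]

theorem comp_mem_trunc_left {m n r : ℕ} (i : Fin m) (h : r + 1 = m + n)
    (μ : P.obj m) {x : P.obj n} (hx : x ∈ P.trunc u₀ k n) : P.comp i h μ x ∈ P.trunc u₀ k r := by
  refine ((P.isEraseStable_univ u₀).image2_comp isEraseStable_trunc).mem_trunc ?_
    ⟨m, n, i, h, μ, Set.mem_univ μ, x, hx, rfl⟩
  rintro r hr _ ⟨m, n, i, h, μ, -, x, hx, rfl⟩
  have := i.2
  rw [eq_zero_of_mem_trunc (by omega) hx, map_zero]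

theorem comp_eq_smul_erase {r : ℕ} (i : Fin (r + 1)) (h : r + 1 = r + 1 + 0)
    (x : P.obj (r + 1)) (c : 𝕜) : P.comp i h x (c • u₀) = c • P.erase u₀ i x :=
  map_smul _ c u₀

theorem comp_mem_trunc_right (h0 : P.IsZeroUnit u₀) {m n r : ℕ} (i : Fin m) (h : r + 1 = m + n)
    {x : P.obj m} (hx : x ∈ P.trunc u₀ k m) (ν : P.obj n) : P.comp i h x ν ∈ P.trunc u₀ k r := by
  refine (isEraseStable_trunc.image2_comp (P.isEraseStable_univ u₀)).mem_trunc ?_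
    ⟨m, n, i, h, x, hx, ν, Set.mem_univ ν, rfl⟩
  rintro r hr _ ⟨m, n, i, h, x, hx, ν, -, rfl⟩
  obtain _ | n := n
  · obtain rfl : m = r + 1 := by omega
    obtain ⟨c, rfl⟩ := h0.2 ν
    simp only [comp_eq_smul_erase, eq_zero_of_mem_trunc hr (isEraseStable_trunc i x hx), smul_zero]
  · rw [eq_zero_of_mem_trunc (by omega) hx, map_zero, LinearMap.zero_apply]

theorem isIdeal_trunc (h0 : P.IsZeroUnit u₀) : P.IsIdeal (P.trunc u₀ k) :=
  ⟨⟨fun _ σ _ hx => act_mem_trunc σ hx,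
    fun _ _ _ i h μ _ hx => comp_mem_trunc_left i h μ hx⟩,
   ⟨fun _ σ _ hx => act_mem_trunc σ hx,
    fun _ _ _ i h _ hx ν => comp_mem_trunc_right h0 i h hx ν⟩⟩

theorem comp_mem_trunc_add {a b m n r : ℕ} (i : Fin m) (h : r + 1 = m + n)
    {x : P.obj m} (hx : x ∈ P.trunc u₀ a m) {y : P.obj n} (hy : y ∈ P.trunc u₀ b n) :
    P.comp i h x y ∈ P.trunc u₀ (a + b - 1) r := by
  refine (isEraseStable_trunc.image2_comp isEraseStable_trunc).mem_trunc ?_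
    ⟨m, n, i, h, x, hx, y, hy, rfl⟩
  rintro r hr _ ⟨m, n, i, h, x, hx, y, hy, rfl⟩
  obtain hm | hn : m < a ∨ n < b := by omega
  · rw [eq_zero_of_mem_trunc hm hx, map_zero, LinearMap.zero_apply]
  · rw [eq_zero_of_mem_trunc hn hy, map_zero]

theorem exists_trunc_eq_bot (h0 : P.IsZeroUnit u₀)
    (hart : P.IsLeftArtinian ∨ P.IsRightArtinian) : ∃ k, P.trunc u₀ k = ⊥ := by
  obtain ⟨N, hN⟩ : ∃ N, ∀ t, N ≤ t → P.trunc u₀ t = P.trunc u₀ N :=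
    hart.elim (fun hl => hl _ (fun _ => (isIdeal_trunc h0).1) trunc_antitone)
      (fun hr => hr _ (fun _ => (isIdeal_trunc h0).2) trunc_antitone)
  refine ⟨N, funext fun n => ?_⟩
  rw [← hN (N + n + 1) (by omega)]
  exact trunc_of_lt (by omega)

theorem trunc_two_eq_bot (h0 : P.IsZeroUnit u₀) (hart : P.IsLeftArtinian ∨ P.IsRightArtinian)
    (hsemi : P.IsSemiprime) : P.trunc u₀ 2 = ⊥ := by
  obtain ⟨k, hk⟩ := exists_trunc_eq_bot h0 hart
  have descend (j : ℕ) (hj : P.trunc u₀ (j + 3) = ⊥) : P.trunc u₀ (j + 2) = ⊥ := by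
    refine funext (hsemi _ (isIdeal_trunc h0) fun m n r i h x hx y hy => ?_)
    have hxy := trunc_antitone (by omega : j + 3 ≤ j + 2 + (j + 2) - 1) r
      (comp_mem_trunc_add i h hx hy)
    rwa [hj] at hxy
  have start : P.trunc u₀ (k + 2) = ⊥ := le_bot_iff.1 (hk ▸ trunc_antitone (Nat.le_add_right k 2))
  clear hk
  induction k with
  | zero => exact start
  | succ k ih => exact ih (descend k start)

end Truncation

section ErasureUniqueness

variable {𝕜 : Type u} [CommRing 𝕜] {P : SymmOperad.{u, v} 𝕜} {u₀ : P.obj 0}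

theorem IsEraseStable.eq_zero {S : ∀ n, Set (P.obj n)} (hS : P.IsEraseStable u₀ S)
    (hT : P.trunc u₀ 2 = ⊥) (h₀ : ∀ x ∈ S 0, x = 0) (h₁ : ∀ x ∈ S 1, x = 0)
    {n : ℕ} {x : P.obj n} (hx : x ∈ S n) : x = 0 := by
  have : x ∈ P.trunc u₀ 2 n := hS.mem_trunc (fun k hk => by interval_cases k <;> assumption) hx
  rwa [hT] at this

theorem erase_one : P.erase u₀ 0 P.one = u₀ :=
  P.one_comp u₀

theorem erase_zero_surjective (h0 : P.IsZeroUnit u₀) :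
    Function.Surjective (P.erase u₀ (0 : Fin 1)) := by
  intro x
  obtain ⟨c, rfl⟩ := h0.2 x
  exact ⟨c • P.one, by rw [map_smul, erase_one]⟩

variable (u₀) in
/-- A family of maps `P(n) → P(n)` commutes with all the operators `erase`.  For the components of
a derivation this means that it kills `u₀`. -/
def CommutesWithErase (f : ∀ n, P.obj n → P.obj n) : Prop :=
  ∀ ⦃n : ℕ⦄ (j : Fin (n + 1)) (θ : P.obj (n + 1)),
    P.erase u₀ j (f (n + 1) θ) = f n (P.erase u₀ j θ)

theorem CommutesWithErase.eq_of_arity_one {f g : ∀ n, P.obj n → P.obj n}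
    (hf : CommutesWithErase u₀ f) (hg : CommutesWithErase u₀ g) (h0 : P.IsZeroUnit u₀)
    (hT : P.trunc u₀ 2 = ⊥) (h : ∀ a, f 1 a = g 1 a) (n : ℕ) (θ : P.obj n) : f n θ = g n θ := by
  have hS : P.IsEraseStable u₀ fun n => Set.range fun θ => f n θ - g n θ := by
    rintro n j _ ⟨θ, rfl⟩
    exact ⟨P.erase u₀ j θ, by rw [map_sub, hf, hg]⟩
  refine sub_eq_zero.1 (hS.eq_zero hT ?_ ?_ ⟨θ, rfl⟩)
  · rintro _ ⟨x, rfl⟩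
    obtain ⟨a, rfl⟩ := erase_zero_surjective h0 x
    simp only [← hf 0 a, ← hg 0 a, h, sub_self]
  · rintro _ ⟨a, rfl⟩
    exact sub_eq_zero.2 (h a)

variable {D : ∀ n, Module.End 𝕜 (P.obj n)}

theorem CommutesWithErase.map_act (hD : CommutesWithErase u₀ fun n => D n)
    (hT : P.trunc u₀ 2 = ⊥) {n : ℕ} (σ : Equiv.Perm (Fin n)) (θ : P.obj n) :
    D n (P.act σ θ) = P.act σ (D n θ) := by
  have hS : P.IsEraseStable u₀ fun n =>
      {z | ∃ (σ : Equiv.Perm (Fin n)) (θ : P.obj n), D n (P.act σ θ) - P.act σ (D n θ) = z} := by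
    rintro n j _ ⟨σ, θ, rfl⟩
    obtain ⟨τ, hτ⟩ := P.exists_erase_act u₀ j σ
    exact ⟨τ, P.erase u₀ (σ j) θ, by rw [map_sub, hD, hτ, hτ, hD]⟩
  refine sub_eq_zero.1 (hS.eq_zero hT ?_ ?_ ⟨σ, θ, rfl⟩) <;> rintro _ ⟨σ, θ, rfl⟩ <;>
    rw [Subsingleton.elim σ 1, P.act_one, P.act_one, sub_self]

theorem CommutesWithErase.map_comp_zero (hD : CommutesWithErase u₀ fun n => D n)
    (h0 : P.IsZeroUnit u₀) (hu : D 0 u₀ = 0) {m r : ℕ} (i : Fin m) (h : r + 1 = m + 0)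
    (μ : P.obj m) (ν : P.obj 0) :
    D r (P.comp i h μ ν) = P.comp i h (D m μ) ν + P.comp i h μ (D 0 ν) := by
  obtain rfl : m = r + 1 := by omega
  obtain ⟨c, rfl⟩ := h0.2 ν
  have hμ : D r (P.comp i h μ u₀) = P.comp i h (D (r + 1) μ) u₀ := (hD i μ).symm
  simp only [map_smul, hμ, hu, smul_zero, map_zero, add_zero]

theorem CommutesWithErase.map_comp (hD : CommutesWithErase u₀ fun n => D n)
    (h0 : P.IsZeroUnit u₀) (hT : P.trunc u₀ 2 = ⊥) (hu : D 0 u₀ = 0)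
    (hmul : ∀ a b : P.obj 1, D 1 (a * b) = D 1 a * b + a * D 1 b)
    {m n r : ℕ} (i : Fin m) (h : r + 1 = m + n) (μ : P.obj m) (ν : P.obj n) :
    D r (P.comp i h μ ν) = P.comp i h (D m μ) ν + P.comp i h μ (D n ν) := by
  have hS : P.IsEraseStable u₀ fun r => {z | ∃ (m n : ℕ) (i : Fin m) (h : r + 1 = m + n)
      (μ : P.obj m) (ν : P.obj n),
      D r (P.comp i h μ ν) - (P.comp i h (D m μ) ν + P.comp i h μ (D n ν)) = z} := by
    rintro r p _ ⟨m, n, i, h, μ, ν, rfl⟩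
    induction m, n, i, h, p using input_cases with
    | inner m n i h j =>
      exact ⟨m, n, i, by omega, μ, P.erase u₀ j ν, by
        simp only [map_sub, map_add, hD _ _, erase_comp_inner]⟩
    | outer m n k i h =>
      exact ⟨m, n, i, by omega, P.erase u₀ k μ, ν, by
        simp only [map_sub, map_add, hD _ _, erase_comp_outer]⟩
  refine sub_eq_zero.1 (hS.eq_zero hT ?_ ?_ ⟨m, n, i, h, μ, ν, rfl⟩) <;>
    rintro _ ⟨m, n, i, h, μ, ν, rfl⟩ <;> refine sub_eq_zero.2 ?_ <;> have hi := i.2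
  · obtain rfl : n = 0 := by omega
    exact hD.map_comp_zero h0 hu i h μ ν
  · obtain rfl | ⟨rfl, rfl⟩ : n = 0 ∨ m = 1 ∧ n = 1 := by omega
    · exact hD.map_comp_zero h0 hu i h μ ν
    · obtain rfl := Subsingleton.elim 0 i
      exact hmul μ ν

theorem CommutesWithErase.mem_der (hD : CommutesWithErase u₀ fun n => D n)
    (h0 : P.IsZeroUnit u₀) (hT : P.trunc u₀ 2 = ⊥)
    (hmul : ∀ a b : P.obj 1, D 1 (a * b) = D 1 a * b + a * D 1 b) : D ∈ P.Der := by
  have hone : D 1 (1 : P.obj 1) = 0 := by simpa only [mul_one, one_mul, left_eq_add] using hmul 1 1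
  have hu : D 0 u₀ = 0 := by
    have := hD 0 P.one
    rw [erase_one] at this
    exact this.symm.trans ((congrArg _ hone).trans (map_zero _))
  exact ⟨fun _ => hD.map_act hT, fun _ _ _ => hD.map_comp h0 hT hu hmul⟩

end ErasureUniqueness

section Extension

variable {𝕜 : Type u} [CommRing 𝕜] (P : SymmOperad.{u, v} 𝕜) {u₀ : P.obj 0}

/-- The right-nested powers `u₂ ∘₂ (u₂ ∘₂ ⋯ (u₂ ∘₂ u₀))` of a `2`-unit, in each arity. -/
def iterUnit (u₀ : P.obj 0) (u₂ : P.obj 2) : ∀ n, P.obj n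
  | 0 => u₀
  | n + 1 => P.comp (1 : Fin 2) (by omega) u₂ (iterUnit u₀ u₂ n)

theorem erase_iterUnit {u₂ : P.obj 2} (hu₂ : P.IsTwoUnit u₀ u₂) {n : ℕ} (j : Fin (n + 1)) :
    P.erase u₀ j (P.iterUnit u₀ u₂ (n + 1)) = P.iterUnit u₀ u₂ n := by
  induction n with
  | zero =>
    obtain rfl : j = 0 := Fin.fin_one_eq_zero j
    refine (P.erase_comp_outer (n := 0) u₀ 0 (0 : Fin 1) rfl u₂ u₀).trans ?_
    exact (congrArg (P.comp 0 _ · u₀) hu₂.1).trans (P.one_comp u₀)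
  | succ n ih =>
    cases j using Fin.cases with
    | zero =>
      refine (P.erase_comp_outer u₀ 0 (0 : Fin 1) (by omega) u₂ _).trans ?_
      exact (congrArg (P.comp 0 _ · _) hu₂.1).trans (P.one_comp _)
    | succ j =>
      have hj : j.succ = blockPos (1 : Fin 2) (by omega) (Sum.inl j) :=
        Fin.ext (Nat.add_comm j 1)
      rw [hj, iterUnit, erase_comp_inner, ih, iterUnit]

/-- The restriction `P(n) → P(1)` to the input `i`, which closes all other inputs with `u₀`. -/
def restrictInput (u₀ : P.obj 0) : ∀ {n : ℕ}, Fin n → P.obj n →ₗ[𝕜] P.obj 1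
  | 0 => Fin.elim0
  | 1 => fun _ => LinearMap.id
  | _ + 2 => Fin.cases (restrictInput u₀ 0 ∘ₗ P.erase u₀ 1) fun i =>
      restrictInput u₀ i ∘ₗ P.erase u₀ 0

theorem restrictInput_erase {n : ℕ} (j : Fin (n + 1)) (i : Fin n) (θ : P.obj (n + 1)) :
    P.restrictInput u₀ i (P.erase u₀ j θ) = P.restrictInput u₀ (j.succAbove i) θ := by
  induction n with
  | zero => exact i.elim0
  | succ n ih =>
    cases j using Fin.cases with
    | zero => rfl
    | succ j =>
      obtain _ | n := n
      · rw [Fin.fin_one_eq_zero i, Fin.fin_one_eq_zero j]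
        rfl
      cases i using Fin.cases with
      | succ i =>
        rw [Fin.succ_succAbove_succ]
        exact (congrArg (P.restrictInput u₀ i) (P.erase_erase u₀ j.zero_le θ).symm).trans (ih j i _)
      | zero =>
        cases j using Fin.cases with
        | zero => rfl
        | succ j =>
          have hj : 1 ≤ j.succ := Fin.succ_le_succ_iff.2 j.zero_le
          exact (congrArg (P.restrictInput u₀ 0) (P.erase_erase u₀ hj θ).symm).trans (ih j.succ 0 _)

theorem erase_sum_comp {n : ℕ} (j : Fin (n + 1)) (θ : P.obj (n + 1)) {b : Fin (n + 1) → P.obj 1}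
    (hb : P.erase u₀ 0 (b j) = 0) :
    P.erase u₀ j (∑ i, P.comp i rfl θ (b i)) =
      ∑ i : Fin n, P.comp i rfl (P.erase u₀ j θ) (b (j.succAbove i)) := by
  have inner : P.erase u₀ j (P.comp j rfl θ (b j)) = 0 := by
    have := P.erase_comp_inner u₀ j 0 rfl θ (b j)
    rwa [hb, map_zero] at this
  have outer (i : Fin n) : P.erase u₀ j (P.comp (j.succAbove i) rfl θ (b (j.succAbove i))) =
      P.comp i rfl (P.erase u₀ j θ) (b (j.succAbove i)) := by
    have hpos : blockPos (r := n + 1) (n := 1) (j.succAbove i) rfl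
        (Sum.inr ⟨j, j.ne_succAbove i⟩) = j := Fin.ext (ite_self _)
    have := P.erase_comp_outer u₀ j i rfl θ (b (j.succAbove i))
    rwa [hpos] at this
  rw [Fin.sum_univ_succAbove _ j, map_add, inner, zero_add, map_sum]
  exact Finset.sum_congr rfl fun i _ => outer i

theorem commutesWithErase_adFun {b : P.obj 1} (hb : P.erase u₀ 0 b = 0) :
    CommutesWithErase u₀ fun _ => P.adFun b := by
  intro n j θ
  have hj : blockPos (0 : Fin 1) (Nat.add_comm (n + 1) 1) (Sum.inl j) = j :=
    Fin.ext (Nat.zero_add j)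
  have := P.erase_comp_inner u₀ 0 j (Nat.add_comm (n + 1) 1) b θ
  rw [hj] at this
  simp only [adFun]
  rw [map_sub, P.erase_sum_comp j θ hb, this]

/-- The extension to all arities of a linear map `δ` on `P(1)`: the elements `δ (θᵢ)`, where `θᵢ`
is the restriction of `θ` to the input `i`, are inserted in the `n`-ary power of the `2`-unit. -/
def extendEnd (u₀ : P.obj 0) (u₂ : P.obj 2) (δ : Module.End 𝕜 (P.obj 1)) (n : ℕ) :
    Module.End 𝕜 (P.obj n) :=
  ∑ i, P.comp i rfl (P.iterUnit u₀ u₂ n) ∘ₗ δ ∘ₗ P.restrictInput u₀ i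

theorem extendEnd_apply (u₂ : P.obj 2) (δ : Module.End 𝕜 (P.obj 1)) {n : ℕ} (θ : P.obj n) :
    P.extendEnd u₀ u₂ δ n θ =
      ∑ i, P.comp i rfl (P.iterUnit u₀ u₂ n) (δ (P.restrictInput u₀ i θ)) := by
  simp only [extendEnd, LinearMap.sum_apply, LinearMap.comp_apply]

variable {u₂ : P.obj 2} (hu₂ : P.IsTwoUnit u₀ u₂) {δ : Module.End 𝕜 (P.obj 1)}
include hu₂

theorem extendEnd_one : P.extendEnd u₀ u₂ δ 1 = δ := by
  ext a
  rw [extendEnd_apply, Fin.sum_univ_one]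
  exact (congrArg (P.comp 0 rfl · (δ a)) hu₂.2).trans (P.one_comp (δ a))

theorem commutesWithErase_extendEnd (hδ : ∀ a, P.erase u₀ 0 (δ a) = 0) :
    CommutesWithErase u₀ fun n => P.extendEnd u₀ u₂ δ n := by
  intro n j θ
  simp only [extendEnd_apply]
  rw [P.erase_sum_comp j _ (hδ _), P.erase_iterUnit hu₂]
  simp only [restrictInput_erase]

end Extension

section Augmentation

variable {𝕜 : Type u} [CommRing 𝕜] {P : SymmOperad.{u, v} 𝕜} {u₀ : P.obj 0}

theorem mem_augIdeal_iff (h0 : P.IsZeroUnit u₀) {a : P.obj 1} :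
    a ∈ P.augIdeal ↔ P.erase u₀ 0 a = 0 := by
  refine ⟨fun h => h u₀, fun h x => ?_⟩
  obtain ⟨c, rfl⟩ := h0.2 x
  exact (map_smul _ c u₀).trans ((congrArg (c • ·) h).trans (smul_zero c))

/-- The coordinate of an element of `P(0)` along a `0`-unit. -/
noncomputable def zeroCoeff (h0 : P.IsZeroUnit u₀) : P.obj 0 →ₗ[𝕜] 𝕜 :=
  (LinearEquiv.ofBijective (LinearMap.toSpanSingleton 𝕜 (P.obj 0) u₀) h0).symm.toLinearMap

variable (h0 : P.IsZeroUnit u₀)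

theorem zeroCoeff_smul (x : P.obj 0) : zeroCoeff h0 x • u₀ = x :=
  (LinearEquiv.ofBijective (LinearMap.toSpanSingleton 𝕜 (P.obj 0) u₀) h0).apply_symm_apply x

theorem zeroCoeff_smul_unit (c : 𝕜) : zeroCoeff h0 (c • u₀) = c :=
  (LinearEquiv.ofBijective (LinearMap.toSpanSingleton 𝕜 (P.obj 0) u₀) h0).symm_apply_apply c

/-- The augmentation `ε : P(1) → 𝕜`, given by `a ∘₁ u₀ = ε(a) u₀`, as a linear map. -/
noncomputable def aug : P.obj 1 →ₗ[𝕜] 𝕜 :=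
  zeroCoeff h0 ∘ₗ P.erase u₀ 0

theorem aug_one : aug h0 1 = 1 := by
  refine (congrArg (zeroCoeff h0) erase_one).trans ?_
  simpa only [one_smul] using zeroCoeff_smul_unit h0 1

theorem aug_coe (a : P.augIdeal) : aug h0 (a : P.obj 1) = 0 :=
  (congrArg (zeroCoeff h0) ((mem_augIdeal_iff h0).1 a.2)).trans (map_zero _)

/-- The projection `a ↦ a - ε(a) 𝟙` of `P(1) = 𝕜 𝟙 ⊕ Ā` to the augmentation ideal `Ā`. -/
noncomputable def augProj : P.obj 1 →ₗ[𝕜] P.augIdeal :=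
  LinearMap.codRestrict P.augIdeal.toSubmodule
    (LinearMap.id - LinearMap.toSpanSingleton 𝕜 (P.obj 1) 1 ∘ₗ aug h0) fun a => by
      have hone : P.erase u₀ 0 (1 : P.obj 1) = u₀ := erase_one
      refine (mem_augIdeal_iff h0).2 ?_
      simp only [LinearMap.sub_apply, LinearMap.id_apply, LinearMap.comp_apply,
        LinearMap.toSpanSingleton_apply, map_sub, map_smul, hone, aug, zeroCoeff_smul, sub_self]

theorem coe_augProj (a : P.obj 1) : (augProj h0 a : P.obj 1) = a - aug h0 a • 1 := rfl

theorem aug_smul_one_add_augProj (a : P.obj 1) : aug h0 a • 1 + (augProj h0 a : P.obj 1) = a := by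
  rw [coe_augProj, add_sub_cancel]

theorem augProj_one : augProj h0 1 = 0 :=
  Subtype.ext <| by rw [coe_augProj, aug_one, one_smul, sub_self, ZeroMemClass.coe_zero]

theorem augProj_coe (a : P.augIdeal) : augProj h0 (a : P.obj 1) = a :=
  Subtype.ext <| by rw [coe_augProj, aug_coe, zero_smul, sub_zero]

theorem augProj_mul_sub_mul_augProj (a b : P.obj 1) :
    (augProj h0 a : P.obj 1) * b - b * augProj h0 a = a * b - b * a := by
  simp only [coe_augProj, sub_mul, mul_sub, smul_one_mul, mul_smul_one, sub_sub_sub_cancel_right]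

include h0 in
theorem linearMap_ext_augIdeal {M : Type*} [AddCommGroup M] [Module 𝕜 M] {f g : P.obj 1 →ₗ[𝕜] M}
    (h₁ : f 1 = g 1) (h : ∀ a : P.augIdeal, f a = g a) : f = g := by
  ext a
  rw [← aug_smul_one_add_augProj h0 a, map_add, map_add, map_smul, map_smul, h₁, h]

/-- The extension by zero of an endomorphism of `Ā` to `P(1) = 𝕜 𝟙 ⊕ Ā`. -/
noncomputable def augExtend (δ : Module.End 𝕜 P.augIdeal) : Module.End 𝕜 (P.obj 1) :=
  P.augIdeal.toSubmodule.subtype ∘ₗ δ ∘ₗ augProj h0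

theorem augExtend_apply (δ : Module.End 𝕜 P.augIdeal) (a : P.obj 1) :
    augExtend h0 δ a = δ (augProj h0 a) := rfl

theorem augExtend_coe (δ : Module.End 𝕜 P.augIdeal) (a : P.augIdeal) :
    augExtend h0 δ a = δ a := by
  rw [augExtend_apply, augProj_coe]

theorem augExtend_one (δ : Module.End 𝕜 P.augIdeal) : augExtend h0 δ 1 = 0 := by
  rw [augExtend_apply, augProj_one, map_zero, ZeroMemClass.coe_zero]

theorem augExtend_mul (δ : algDer 𝕜 P.augIdeal) (a b : P.obj 1) :
    augExtend h0 δ.1 (a * b) = augExtend h0 δ.1 a * b + a * augExtend h0 δ.1 b := by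
  have leibniz (x y : P.augIdeal) : augExtend h0 δ.1 ((x : P.obj 1) * y) =
      augExtend h0 δ.1 x * y + x * augExtend h0 δ.1 y := by
    have := augExtend_coe h0 δ.1 (x * y)
    simp only [augExtend_coe]
    exact this.trans (congrArg Subtype.val (δ.2 x y))
  obtain ⟨α, x, rfl⟩ : ∃ (α : 𝕜) (x : P.augIdeal), α • 1 + (x : P.obj 1) = a :=
    ⟨_, _, aug_smul_one_add_augProj h0 a⟩
  obtain ⟨β, y, rfl⟩ : ∃ (β : 𝕜) (y : P.augIdeal), β • 1 + (y : P.obj 1) = b :=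
    ⟨_, _, aug_smul_one_add_augProj h0 b⟩
  simp only [add_mul, mul_add, smul_one_mul, mul_smul_one, map_add, map_smul, augExtend_one,
    leibniz, smul_zero, zero_add]
  abel

end Augmentation

section LieAlgebra

variable {𝕜 : Type u} [CommRing 𝕜] (P : SymmOperad.{u, v} 𝕜)

theorem derivation_mul (D : P.Der) (a b : P.obj 1) : D.1 1 (a * b) = D.1 1 a * b + a * D.1 1 b :=
  D.2.2 1 1 1 0 rfl a b

theorem derivation_one (D : P.Der) : D.1 1 (1 : P.obj 1) = 0 := by
  simpa only [mul_one, one_mul, left_eq_add] using P.derivation_mul D 1 1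

theorem derivation_mem_augIdeal (D : P.Der) {a : P.obj 1} (ha : a ∈ P.augIdeal) :
    D.1 1 a ∈ P.augIdeal := by
  intro x
  have h := D.2.2 1 0 0 0 (Nat.add_comm 0 1) a x
  rw [ha x, map_zero, ha (D.1 0 x), add_zero] at h
  exact h.symm

/-- The map `ρ : Der(P) → Der(Ā)` restricting a derivation to the augmentation ideal. -/
def derRestrict : P.Der →ₗ⁅𝕜⁆ algDer 𝕜 P.augIdeal where
  toFun D :=
    ⟨(D.1 1).restrict (p := P.augIdeal.toSubmodule) (q := P.augIdeal.toSubmodule)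
      fun _ => P.derivation_mem_augIdeal D, fun a b => Subtype.ext (P.derivation_mul D a b)⟩
  map_add' _ _ := rfl
  map_smul' _ _ := rfl
  map_lie' := rfl

theorem coe_derRestrict_apply (D : P.Der) (a : P.augIdeal) :
    (((P.derRestrict D).1 a : P.augIdeal) : P.obj 1) = D.1 1 a := rfl

/-- The derivation multiplying `P(n)` by `n - 1`. -/
def eulerDer : P.Der :=
  ⟨fun n => ((n : 𝕜) - 1) • LinearMap.id, fun n σ θ => (map_smul (P.act σ) _ θ).symm,
    fun m n r i h μ ν => by
      have h' : (r : 𝕜) + 1 = m + n := by exact_mod_cast congrArg (Nat.cast (R := 𝕜)) h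
      simp only [LinearMap.smul_apply, LinearMap.id_apply, map_smul, ← add_smul]
      congr 1
      linear_combination h'⟩

/-- The map `ι : 𝕜 → Der(P)`. -/
def gradingDer : 𝕜 →ₗ⁅𝕜⁆ P.Der :=
  { LinearMap.toSpanSingleton 𝕜 P.Der P.eulerDer with
    map_lie' := by
      intro a b
      simp [LieRing.of_associative_ring_bracket, mul_comm] }

theorem gradingDer_apply (c : 𝕜) (n : ℕ) (θ : P.obj n) :
    (P.gradingDer c).1 n θ = (((n : 𝕜) - 1) * c) • θ := by
  rw [mul_comm, mul_smul]
  rfl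

theorem derRestrict_gradingDer (c : 𝕜) : P.derRestrict (P.gradingDer c) = 0 := by
  refine Subtype.ext (LinearMap.ext fun a => Subtype.ext ?_)
  rw [coe_derRestrict_apply, gradingDer_apply, Nat.cast_one, sub_self, zero_mul, zero_smul]
  rfl

theorem gradingDer_mem_innerDer (c : 𝕜) : P.gradingDer c ∈ P.innerDer := by
  refine ⟨-c • P.one, fun n θ => ?_⟩
  simp only [gradingDer_apply, adFun, map_smul, LinearMap.smul_apply, P.one_comp, P.comp_one,
    Finset.sum_const, Finset.card_univ, Fintype.card_fin, ← Nat.cast_smul_eq_nsmul 𝕜, smul_smul,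
    ← sub_smul]
  congr 1
  ring

variable {P} in
theorem adFun_one_eq (b a : P.obj 1) : P.adFun b a = b * a - a * b := by
  rw [adFun, Fin.sum_univ_one]
  rfl

variable {P} {u₀ : P.obj 0}

theorem commutesWithErase_derivation {D : P.Der} (hD : D.1 0 u₀ = 0) :
    CommutesWithErase u₀ fun n => D.1 n := by
  intro n j θ
  have h := D.2.2 _ _ _ j (rfl : n + 1 = n + 1 + 0) θ u₀
  rw [hD, map_zero, add_zero] at h
  exact h.symm

variable (h0 : P.IsZeroUnit u₀)

/-- The scalar `c` such that a derivation agrees with `gradingDer c` on `P(0)`. -/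
noncomputable def gradingCoeff : P.Der →ₗ[𝕜] 𝕜 :=
  -(zeroCoeff h0 ∘ₗ LinearMap.applyₗ u₀ ∘ₗ LinearMap.proj 0 ∘ₗ P.Der.toSubmodule.subtype)

theorem gradingCoeff_apply (D : P.Der) : gradingCoeff h0 D = -zeroCoeff h0 (D.1 0 u₀) := rfl

theorem derivation_zero_apply (D : P.Der) (x : P.obj 0) :
    D.1 0 x = -gradingCoeff h0 D • x := by
  obtain ⟨c, rfl⟩ := h0.2 x
  rw [gradingCoeff_apply, neg_neg, map_smul, smul_comm, zeroCoeff_smul]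

theorem gradingCoeff_gradingDer (c : 𝕜) : gradingCoeff h0 (P.gradingDer c) = c := by
  rw [gradingCoeff_apply, gradingDer_apply, zeroCoeff_smul_unit]
  simp

theorem gradingCoeff_lie (D E : P.Der) : gradingCoeff h0 ⁅D, E⁆ = 0 := by
  have h : (⁅D, E⁆ : P.Der).1 0 u₀ = D.1 0 (E.1 0 u₀) - E.1 0 (D.1 0 u₀) := rfl
  rw [gradingCoeff_apply, h, derivation_zero_apply h0 E u₀, derivation_zero_apply h0 D u₀,
    map_smul, map_smul, derivation_zero_apply h0 E u₀, derivation_zero_apply h0 D u₀, smul_comm,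
    sub_self, map_zero, neg_zero]

theorem commutesWithErase_of_gradingCoeff_eq_zero {D : P.Der} (hD : gradingCoeff h0 D = 0) :
    CommutesWithErase u₀ fun n => D.1 n :=
  commutesWithErase_derivation <| by rw [derivation_zero_apply h0, hD, neg_zero, zero_smul]

theorem derivation_eq_zero (hT : P.trunc u₀ 2 = ⊥) {D : P.Der} (hc : gradingCoeff h0 D = 0)
    (hD : P.derRestrict D = 0) : D = 0 := by
  have h₁ : D.1 1 = 0 := linearMap_ext_augIdeal h0 (P.derivation_one D) fun a => by
    rw [← coe_derRestrict_apply, hD]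
    rfl
  refine Subtype.ext (funext fun n => LinearMap.ext fun θ => ?_)
  exact (commutesWithErase_of_gradingCoeff_eq_zero h0 hc).eq_of_arity_one (g := fun _ _ => 0)
    (fun _ _ _ => map_zero _) h0 hT (fun a => by rw [h₁]; rfl) n θ

theorem eq_gradingDer_of_derRestrict_eq_zero (hT : P.trunc u₀ 2 = ⊥) {D : P.Der}
    (hD : P.derRestrict D = 0) : D = P.gradingDer (gradingCoeff h0 D) := by
  refine sub_eq_zero.1 (derivation_eq_zero h0 hT ?_ ?_)
  · rw [map_sub, gradingCoeff_gradingDer, sub_self]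
  · rw [map_sub, hD, derRestrict_gradingDer, sub_self]

include h0 in
theorem exact_gradingDer_derRestrict (hT : P.trunc u₀ 2 = ⊥) :
    Function.Exact P.gradingDer P.derRestrict := by
  refine fun D => ⟨fun hD => ⟨_, (eq_gradingDer_of_derRestrict_eq_zero h0 hT hD).symm⟩, ?_⟩
  rintro ⟨c, rfl⟩
  exact P.derRestrict_gradingDer c

include h0 in
theorem derRestrict_surjective {u₂ : P.obj 2} (hu₂ : P.IsTwoUnit u₀ u₂)
    (hT : P.trunc u₀ 2 = ⊥) : Function.Surjective P.derRestrict := by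
  intro δ
  have h₁ : P.extendEnd u₀ u₂ (augExtend h0 δ.1) 1 = augExtend h0 δ.1 := P.extendEnd_one hu₂
  have hcomm := P.commutesWithErase_extendEnd hu₂ (δ := augExtend h0 δ.1) fun a =>
    (mem_augIdeal_iff h0).1 (δ.1 (augProj h0 a)).2
  refine ⟨⟨_, hcomm.mem_der h0 hT fun a b => ?_⟩, ?_⟩
  · simpa only [h₁] using augExtend_mul h0 δ a b
  · refine Subtype.ext (LinearMap.ext fun a => Subtype.ext ?_)
    exact (LinearMap.congr_fun h₁ (a : P.obj 1)).trans (augExtend_coe h0 δ.1 a)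

/-- The splitting `Der(P) ≅ 𝕜 ⋊ Der(Ā)`.  Since `gradingCoeff` kills commutators, the action of
`Der(Ā)` on `𝕜` is trivial. -/
noncomputable def derToSemiDirectSum :
    P.Der →ₗ⁅𝕜⁆ LieAlgebra.SemiDirectSum 𝕜 (algDer 𝕜 P.augIdeal)
      (0 : algDer 𝕜 P.augIdeal →ₗ⁅𝕜⁆ LieDerivation 𝕜 𝕜 𝕜) where
  toFun D := ⟨gradingCoeff h0 D, P.derRestrict D⟩
  map_add' D E := by simp
  map_smul' c D := by simp
  map_lie' := by
    intro D E
    have h : ⁅gradingCoeff h0 D, gradingCoeff h0 E⁆ = 0 := by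
      rw [LieRing.of_associative_ring_bracket, mul_comm, sub_self]
    simp [gradingCoeff_lie, h]

theorem derToSemiDirectSum_gradingDer (c : 𝕜) :
    derToSemiDirectSum h0 (P.gradingDer c) = LieAlgebra.SemiDirectSum.inl _ c :=
  LieAlgebra.SemiDirectSum.ext (gradingCoeff_gradingDer h0 c) (P.derRestrict_gradingDer c)

theorem derToSemiDirectSum_bijective {u₂ : P.obj 2} (hu₂ : P.IsTwoUnit u₀ u₂)
    (hT : P.trunc u₀ 2 = ⊥) : Function.Bijective (derToSemiDirectSum h0) := by
  constructor
  · refine (injective_iff_map_eq_zero _).2 fun D hD => derivation_eq_zero h0 hT ?_ ?_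
    · exact congrArg LieAlgebra.SemiDirectSum.left hD
    · exact congrArg LieAlgebra.SemiDirectSum.right hD
  · rintro ⟨c, δ⟩
    obtain ⟨D, rfl⟩ := derRestrict_surjective h0 hu₂ hT δ
    refine ⟨D + P.gradingDer (c - gradingCoeff h0 D), LieAlgebra.SemiDirectSum.ext ?_ ?_⟩
    · change gradingCoeff h0 (D + P.gradingDer _) = c
      rw [map_add, gradingCoeff_gradingDer, add_sub_cancel]
    · change P.derRestrict (D + P.gradingDer _) = P.derRestrict D
      rw [map_add, derRestrict_gradingDer, add_zero]

include h0 in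
theorem derRestrict_mem_algInnerDer {D : P.Der} (hD : D ∈ P.innerDer) :
    P.derRestrict D ∈ algInnerDer 𝕜 P.augIdeal := by
  obtain ⟨lam, hlam⟩ := hD
  refine ⟨augProj h0 lam, fun a => Subtype.ext ?_⟩
  rw [coe_derRestrict_apply, hlam, adFun_one_eq]
  exact (augProj_mul_sub_mul_augProj h0 lam a).symm

theorem mem_innerDer_of_gradingCoeff_eq_zero (hT : P.trunc u₀ 2 = ⊥) {D : P.Der}
    (hc : gradingCoeff h0 D = 0) (hD : P.derRestrict D ∈ algInnerDer 𝕜 P.augIdeal) :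
    D ∈ P.innerDer := by
  obtain ⟨b, hb⟩ := hD
  have h₁ : D.1 1 = LinearMap.mulLeft 𝕜 (b : P.obj 1) - LinearMap.mulRight 𝕜 (b : P.obj 1) :=
    linearMap_ext_augIdeal h0 (by simp [derivation_one]) fun a => congrArg Subtype.val (hb a)
  refine ⟨b, (commutesWithErase_of_gradingCoeff_eq_zero h0 hc).eq_of_arity_one
    (P.commutesWithErase_adFun ((mem_augIdeal_iff h0).1 b.2)) h0 hT fun a => ?_⟩
  rw [h₁, adFun_one_eq]
  rfl

include h0 in
theorem mem_innerDer_iff (hT : P.trunc u₀ 2 = ⊥) (D : P.Der) :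
    D ∈ P.innerDer ↔ P.derRestrict D ∈ algInnerDer 𝕜 P.augIdeal := by
  refine ⟨derRestrict_mem_algInnerDer h0, fun hD => ?_⟩
  have hinner : D - P.gradingDer (gradingCoeff h0 D) ∈ P.innerDer := by
    apply mem_innerDer_of_gradingCoeff_eq_zero h0 hT
    · rw [map_sub, gradingCoeff_gradingDer, sub_self]
    · rwa [map_sub, derRestrict_gradingDer, sub_zero]
  simpa only [sub_add_cancel] using add_mem hinner (P.gradingDer_mem_innerDer (gradingCoeff h0 D))

end LieAlgebra

end SymmOperad

theorem exists_lieQuotientEquiv_of_surjective {R : Type*} {L M : Type*} [CommRing R] [LieRing L]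
    [LieAlgebra R L] [LieRing M] [LieAlgebra R M] (f : L →ₗ⁅R⁆ M) (hf : Function.Surjective f)
    (I : LieIdeal R L) (J : LieIdeal R M) (hIJ : ∀ x, x ∈ I ↔ f x ∈ J) :
    ∃ φ : (L ⧸ I) ≃ₗ⁅R⁆ (M ⧸ J), ∀ x : L,
      φ (LieSubmodule.Quotient.mk x) = LieSubmodule.Quotient.mk (f x) := by
  let g : (L ⧸ I) →ₗ⁅R⁆ (M ⧸ J) :=
    { Submodule.mapQ I.toSubmodule J.toSubmodule f.toLinearMap fun x hx => (hIJ x).1 hx with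
      map_lie' := by
        rintro ⟨x⟩ ⟨y⟩
        exact congrArg LieSubmodule.Quotient.mk (f.map_lie x y) }
  have hg : Function.Bijective g := by
    constructor
    · rw [injective_iff_map_eq_zero]
      rintro ⟨x⟩ hx
      exact (LieSubmodule.Quotient.mk_eq_zero I).2
        ((hIJ x).2 ((LieSubmodule.Quotient.mk_eq_zero J).1 hx))
    · rintro ⟨y⟩
      obtain ⟨x, rfl⟩ := hf y
      exact ⟨LieSubmodule.Quotient.mk x, rfl⟩
  exact ⟨LieEquiv.ofBijective g hg, fun _ => rfl⟩

theorem theorem0p5_general {𝕜 : Type u} [CommRing 𝕜] (P : SymmOperad.{u, v} 𝕜)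
    {u₀ : P.obj 0} {u₂ : P.obj 2} (h0 : P.IsZeroUnit u₀) (hu₂ : P.IsTwoUnit u₀ u₂)
    (hT : P.trunc u₀ 2 = ⊥) :
    ∃ (ι : 𝕜 →ₗ⁅𝕜⁆ P.Der) (ρ : P.Der →ₗ⁅𝕜⁆ algDer 𝕜 P.augIdeal),
      (∀ (c : 𝕜) (n : ℕ) (θ : P.obj n), (ι c).1 n θ = (((n : 𝕜) - 1) * c) • θ) ∧
      (∀ (D : P.Der) (a : P.augIdeal), (((ρ D).1 a : P.augIdeal) : P.obj 1) = D.1 1 a) ∧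
      Function.Injective ι ∧ Function.Exact ι ρ ∧ Function.Surjective ρ ∧
      (∃ (ψ : algDer 𝕜 P.augIdeal →ₗ⁅𝕜⁆ LieDerivation 𝕜 𝕜 𝕜)
        (e : P.Der ≃ₗ⁅𝕜⁆ LieAlgebra.SemiDirectSum 𝕜 (algDer 𝕜 P.augIdeal) ψ),
        (∀ c, e (ι c) = LieAlgebra.SemiDirectSum.inl ψ c) ∧
        (∀ D, LieAlgebra.SemiDirectSum.projr ψ (e D) = ρ D)) ∧
      (∃ φ : P.H1 ≃ₗ⁅𝕜⁆ HH1 𝕜 P.augIdeal,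
        ∀ D : P.Der, φ (LieSubmodule.Quotient.mk D) = LieSubmodule.Quotient.mk (ρ D)) := by
  have hsurj := SymmOperad.derRestrict_surjective h0 hu₂ hT
  have hbij := SymmOperad.derToSemiDirectSum_bijective h0 hu₂ hT
  have hinj : Function.Injective P.gradingDer :=
    Function.LeftInverse.injective (SymmOperad.gradingCoeff_gradingDer h0)
  exact ⟨P.gradingDer, P.derRestrict, P.gradingDer_apply, P.coe_derRestrict_apply, hinj,
    SymmOperad.exact_gradingDer_derRestrict h0 hT, hsurj,
    ⟨0, LieEquiv.ofBijective _ hbij, SymmOperad.derToSemiDirectSum_gradingDer h0, fun _ => rfl⟩,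
    exists_lieQuotientEquiv_of_surjective P.derRestrict hsurj _ _
      (SymmOperad.mem_innerDer_iff h0 hT)⟩

theorem theorem0p5 {𝕜 : Type u} [Field 𝕜] (P : SymmOperad.{u, v} 𝕜)
    (h2 : P.IsTwoUnitary)
    (hart : P.IsLeftArtinian ∨ P.IsRightArtinian)
    (hsemi : P.IsSemiprime) :
    ∃ (ι : 𝕜 →ₗ⁅𝕜⁆ P.Der) (ρ : P.Der →ₗ⁅𝕜⁆ algDer 𝕜 P.augIdeal),
      (∀ (c : 𝕜) (n : ℕ) (θ : P.obj n), (ι c).1 n θ = (((n : 𝕜) - 1) * c) • θ) ∧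
      (∀ (D : P.Der) (a : P.augIdeal), (((ρ D).1 a : P.augIdeal) : P.obj 1) = D.1 1 a) ∧
      Function.Injective ι ∧ Function.Exact ι ρ ∧ Function.Surjective ρ ∧
      (∃ (ψ : algDer 𝕜 P.augIdeal →ₗ⁅𝕜⁆ LieDerivation 𝕜 𝕜 𝕜)
        (e : P.Der ≃ₗ⁅𝕜⁆ LieAlgebra.SemiDirectSum 𝕜 (algDer 𝕜 P.augIdeal) ψ),
        (∀ c, e (ι c) = LieAlgebra.SemiDirectSum.inl ψ c) ∧
        (∀ D, LieAlgebra.SemiDirectSum.projr ψ (e D) = ρ D)) ∧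
      (∃ φ : P.H1 ≃ₗ⁅𝕜⁆ HH1 𝕜 P.augIdeal,
        ∀ D : P.Der, φ (LieSubmodule.Quotient.mk D) = LieSubmodule.Quotient.mk (ρ D)) := by
  obtain ⟨u₀, h0, u₂, hu₂⟩ := h2
  exact theorem0p5_general P h0 hu₂ (SymmOperad.trunc_two_eq_bot h0 hart hsemi)
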